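/- Let $G$ be a finite simple graph with complement $G^c$, and let $\operatorname{mc}(G^c)$ be the number of maximal cliques of $G^c$ (equivalently, of maximal independent sets of $G$). A biclique of $G$ is an unordered pair $\{L,R\}$ of disjoint nonempty vertex sets such that every vertex of $L$ is adjacent in $G$ to every vertex of $R$; a biclique cover of $G$ is a set of bicliques such that every edge of $G$ joins the two sides of one of them; $\operatorname{bc}(G)$ is the minimum size of a biclique cover. A clique tree of $G^c$ is a tree $T$ whose vertices are the maximal cliques of $G^c$ such that every clique on the path of $T$ between $K$ and $K'$ contains $K\cap K'$. An edge-ranking of a tree $T$ with $r$ ranks is a map $\varphi:E(T)\to\{1,\dots,r\}$ such that, for any two distinct edges with the same label, the path between them contains an edge with a larger label; the optimal edge-ranking number $\chi_r'(T)$ is the smallest such $r$. Consider the following algorithm (Algorithm 3). Given $G$ with $G^c$ chordal, take a clique tree $T$ of $G^c$, an optimal edge-ranking $\varphi$ of $T$ with $r=\chi'_r(T)$ ranks, and a numbering $\sigma$ of the vertices of $T$ in the order of a breadth-first search from a leaf (in a one-vertex tree the vertex counts as a leaf). Recursively, starting from $T$: if the current subtree $S$ has more than one vertex, remove its edge $e=K_1K_2$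 with the largest label, let $S_1\ni K_1$ and $S_2\ni K_2$ be the two resulting subtrees, put $L=\bigcup_{K\in S_1}K\setminus(K_1\cap K_2)$ and $R=\bigcup_{K\in S_2}K\setminus(K_1\cap K_2)$, store $\{L,R\}$ with key $\min_{K\in S}\sigma(K)$ in the list of level $r+1-\varphi(e)$, and continue with $S_1$ and $S_2$. Then, for each level $1,\dots,r$, start with an empty collection and go through the list of the level by increasing key: replace every member $\{L',R'\}$ of the collection by $\{L\cup L',R\cup R'\}$ if this is a biclique of $G$, and otherwise by $\{R\cup L',L\cup R'\}$ if that is a biclique of $G$; if no member was replaced, add $\{L,R\}$ to the collection. Return the union of the collections of all levels. Suppose that $G$ is co-chordal (that is, $G^c$ has no induced cycle of length greater than $3$), that every vertex of $G$ lies in at most two maximal independent sets of $G$, and that $G^c$ has a clique tree $T$ with $\chi_r'(T)=\lceil\log_2 \operatorname{mc}(G^c)\rceil$. Then $$\operatorname{bc}(G)=\lceil\log_2\operatorname{mc}(G^c)\rceil .$$ Moreover, for every clique tree $T$ of $G^c$ with $\chi_r'(T)=\lceil\log_2 \operatorname{mc}(G^c)\rceil$, the algorithm has a run that uses $T$, and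 every run that uses $T$ returns a minimum biclique cover of $G$. If $G^c$ is connected, the algorithm has a run, and every run, whichever clique tree of $G^c$ it uses, returns a minimum biclique cover of $G$. -/

import Mathlib

namespace BicliqueCover

/-- A graph is chordal if it has no induced cycle of length greater than three. -/
def IsChordal {V : Type*} (G : SimpleGraph V) : Prop :=
  ∀ n : ℕ, 4 ≤ n → ¬ (SimpleGraph.cycleGraph n).IsIndContained G

/-- The maximal cliques of `G`. -/
abbrev MaxClique {V : Type*} (G : SimpleGraph V) : Type _ :=
  {K : Set V // Maximal G.IsClique K}

/-- `mc(G)`, the number of maximal cliques of `G`. -/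
noncomputable def mc {V : Type*} (G : SimpleGraph V) : ℕ :=
  Nat.card (MaxClique G)

/-- `{L, R}` is a biclique subgraph of `G`: `L` and `R` are disjoint and nonempty and every vertex
of `L` is adjacent in `G` to every vertex of `R`. -/
def IsBiclique {V : Type*} (G : SimpleGraph V) (L R : Set V) : Prop :=
  L.Nonempty ∧ R.Nonempty ∧ Disjoint L R ∧ ∀ u ∈ L, ∀ v ∈ R, G.Adj u v

/-- A biclique cover of `G`: a collection of bicliques `{L, R}` of `G` (unordered pairs) such that
every edge of `G` belongs to at least one of them. -/
def IsBicliqueCover {V : Type*} (G : SimpleGraph V) (C : Set (Sym2 (Set V))) : Prop :=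
  (∀ L R : Set V, s(L, R) ∈ C → IsBiclique G L R) ∧
    ∀ u v : V, G.Adj u v → ∃ L R : Set V, s(L, R) ∈ C ∧ u ∈ L ∧ v ∈ R

/-- `bc(G)`, the minimum size of a biclique cover of `G`. -/
noncomputable def bc {V : Type*} (G : SimpleGraph V) : ℕ :=
  sInf {k : ℕ | ∃ C : Set (Sym2 (Set V)), C.Finite ∧ IsBicliqueCover G C ∧ C.ncard = k}

/-- A minimum biclique cover of `G`. -/
def IsMinimumBicliqueCover {V : Type*} (G : SimpleGraph V) (C : Set (Sym2 (Set V))) : Prop :=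
  C.Finite ∧ IsBicliqueCover G C ∧ C.ncard = bc G

/-- A clique tree of `G`: a tree whose vertices are the maximal cliques of `G`, with the
clique-intersection property. -/
def IsCliqueTree {V : Type*} (G : SimpleGraph V) (T : SimpleGraph (MaxClique G)) : Prop :=
  T.IsTree ∧ ∀ (K₁ K₂ : MaxClique G) (p : T.Walk K₁ K₂), p.IsPath →
    ∀ K ∈ p.support, K₁.1 ∩ K₂.1 ⊆ K.1

/-- `φ` is an edge-ranking of the tree `T` with labels in `{1, …, r}`: two distinct edges with the
same label are separated by an edge with a larger label. (In a tree, the paths from an end of `e₁`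
to an end of `e₂` differ only in whether they contain `e₁` and `e₂`.) -/
def IsEdgeRanking {W : Type*} (T : SimpleGraph W) (r : ℕ) (φ : Sym2 W → ℕ) : Prop :=
  (∀ e ∈ T.edgeSet, 1 ≤ φ e ∧ φ e ≤ r) ∧
    ∀ e₁ ∈ T.edgeSet, ∀ e₂ ∈ T.edgeSet, e₁ ≠ e₂ → φ e₁ = φ e₂ →
      ∀ u ∈ e₁, ∀ v ∈ e₂, ∀ p : T.Walk u v, p.IsPath → ∃ e₃ ∈ p.edges, φ e₁ < φ e₃

/-- The optimal edge-ranking number of a tree. -/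
noncomputable def edgeRankingNumber {W : Type*} (T : SimpleGraph W) : ℕ :=
  sInf {r : ℕ | ∃ φ : Sym2 W → ℕ, IsEdgeRanking T r φ}

/-- Breadth-first search. `BFS T queue seen out` says that the search in the state with queue
`queue` and list `seen` of vertices already taken from the queue can end with the traversal order
`out`. In one step the first vertex `v` of the queue is taken, and its undiscovered neighbours are
appended to the queue, in any order. -/
inductive BFS {W : Type*} (T : SimpleGraph W) : List W → List W → List W → Prop
  | finish (out : List W) : BFS T [] out out
  | step (v : W) (queue seen new out : List W) (hnd : new.Nodup)
      (hnew : ∀ w, w ∈ new ↔ T.Adj v w ∧ w ∉ v :: queue ∧ w ∉ seen)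
      (hrest : BFS T (queue ++ new) (seen ++ [v]) out) : BFS T (v :: queue) seen out

open Classical in
/-- `σ` numbers the vertices of the tree `T`, from `1` on, in the order in which a breadth-first
search from some leaf traverses them (the only vertex of a one-vertex tree counts as a leaf). -/
def IsBFSOrdering {W : Type*} (T : SimpleGraph W) (σ : W → ℕ) : Prop :=
  ∃ (ρ : W) (out : List W), (T.neighborSet ρ).Subsingleton ∧ BFS T [ρ] [] out ∧
    ∀ w, σ w = out.idxOf w + 1

/-- The entry `({L, R}, ord)` of the lists that the algorithm keeps. -/
abbrev Entry (V : Type*) : Type _ := (Set V × Set V) × ℕ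

/-- The union of the cliques in `S`. -/
def cliqueUnion {V : Type*} {H : SimpleGraph V} (S : Set (MaxClique H)) : Set V :=
  ⋃ K ∈ S, K.1

/-- The subroutine `FindBiclique`. `FindBiclique T φ σ r S d` says that a call on the subtree of
`T` with vertex set `S` can add the entries `d i` to the list `bc[i]`, for every level `i`.
If the subtree has more than one vertex, its edge `e = K₁K₂` of largest label is removed;
`S₁` and `S₂` are the vertex sets of the two resulting subtrees. -/
inductive FindBiclique {V : Type*} {H : SimpleGraph V} (T : SimpleGraph (MaxClique H))
    (φ : Sym2 (MaxClique H) → ℕ) (σ : MaxClique H → ℕ) (r : ℕ) :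
    Set (MaxClique H) → (ℕ → List (Entry V)) → Prop
  | small (S : Set (MaxClique H)) (hS : S.Subsingleton) : FindBiclique T φ σ r S (fun _ => [])
  | cut (S S₁ S₂ : Set (MaxClique H)) (K₁ K₂ : MaxClique H) (d₁ d₂ : ℕ → List (Entry V))
      (hS : S.Nontrivial)
      (hunion : S₁ ∪ S₂ = S) (hdisj : Disjoint S₁ S₂)
      (hconn₁ : (T.induce S₁).Connected) (hconn₂ : (T.induce S₂).Connected)
      (hK₁ : K₁ ∈ S₁) (hK₂ : K₂ ∈ S₂) (hadj : T.Adj K₁ K₂)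
      (hmax : ∀ K ∈ S, ∀ K' ∈ S, T.Adj K K' → φ s(K, K') ≤ φ s(K₁, K₂))
      (h₁ : FindBiclique T φ σ r S₁ d₁) (h₂ : FindBiclique T φ σ r S₂ d₂) :
      FindBiclique T φ σ r S (fun i =>
        (if i = r + 1 - φ s(K₁, K₂) then
          [((cliqueUnion S₁ \ (K₁.1 ∩ K₂.1), cliqueUnion S₂ \ (K₁.1 ∩ K₂.1)), sInf (σ '' S))]
        else []) ++ d₁ i ++ d₂ i)

/-- `{L, R}` can be merged into `{L', R'}`, in one of the two orientations. -/
def Mergeable {V : Type*} (G : SimpleGraph V) (B B' : Set V × Set V) : Prop :=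
  IsBiclique G (B.1 ∪ B'.1) (B.2 ∪ B'.2) ∨ IsBiclique G (B.2 ∪ B'.1) (B.1 ∪ B'.2)

open Classical in
/-- The new value of `{L', R'}` when the inner loop of `MergeBiclique` compares it with
`{L, R}`. -/
noncomputable def mergeInto {V : Type*} (G : SimpleGraph V) (B B' : Set V × Set V) :
    Set V × Set V :=
  if IsBiclique G (B.1 ∪ B'.1) (B.2 ∪ B'.2) then (B.1 ∪ B'.1, B.2 ∪ B'.2)
  else if IsBiclique G (B.2 ∪ B'.1) (B.1 ∪ B'.2) then (B.2 ∪ B'.1, B.1 ∪ B'.2)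
  else B'

open Classical in
/-- One round of the outer loop of `MergeBiclique`: `{L, R}` is merged into every member of the
current collection where this is possible, and joins the collection if there is none. -/
noncomputable def mergeRound {V : Type*} (G : SimpleGraph V) (C : List (Set V × Set V))
    (B : Set V × Set V) : List (Set V × Set V) :=
  C.map (mergeInto G B) ++ if ∃ B' ∈ C, Mergeable G B B' then [] else [B]

/-- The subroutine `MergeBiclique`: the entries are sorted by `ord` and then treated one after the
other, starting from the empty collection. -/
def MergeBiclique {V : Type*} (G : SimpleGraph V) (entries : List (Entry V))
    (C : List (Set V × Set V)) : Prop :=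
  ∃ sorted : List (Entry V), sorted.Perm entries ∧ sorted.Pairwise (fun a b => a.2 ≤ b.2) ∧
    C = (sorted.map Prod.fst).foldl (mergeRound G) []

/-- `RunOn G T C`: the algorithm, run on `G` with `T` as the clique tree of `Gᶜ` that it uses, can
return the collection `C`. It takes an optimal edge-ranking `φ` of `T` and a breadth-first
ordering `σ` of `T`, calls `FindBiclique` on `T`, and collects the results of `MergeBiclique` over
the levels `1, …, r`. -/
def RunOn {V : Type*} (G : SimpleGraph V) (T : SimpleGraph (MaxClique Gᶜ))
    (C : Set (Sym2 (Set V))) : Prop :=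
  IsCliqueTree Gᶜ T ∧
    ∃ (r : ℕ) (φ : Sym2 (MaxClique Gᶜ) → ℕ) (σ : MaxClique Gᶜ → ℕ)
      (d : ℕ → List (Entry V)) (M : ℕ → List (Set V × Set V)),
      r = edgeRankingNumber T ∧ IsEdgeRanking T r φ ∧ IsBFSOrdering T σ ∧
        FindBiclique T φ σ r Set.univ d ∧
        (∀ i ∈ Set.Icc 1 r, MergeBiclique G (d i) (M i)) ∧
        C = {B | ∃ i ∈ Set.Icc 1 r, ∃ L R : Set V, (L, R) ∈ M i ∧ B = s(L, R)}

/-- `Run G C`: the algorithm with input `G` can return `C`. -/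
def Run {V : Type*} (G : SimpleGraph V) (C : Set (Sym2 (Set V))) : Prop :=
  ∃ T : SimpleGraph (MaxClique Gᶜ), RunOn G T C

end BicliqueCover

/-! Lower bound (`IsBicliqueCover.mc_le`): choose one side of every biclique in a cover and send a
maximal clique of `Gᶜ` to the set of bicliques whose chosen side it meets. Distinct cliques contain
ends of an edge of `G`, and a biclique covering that edge tells them apart, so `mc Gᶜ ≤ 2 ^ k` for a
cover of size `k`.

Upper bound (`RunOn.spec`): the stored bicliques cover `G`, and it suffices that each level
collapses to at most one biclique. The ranking makes the subtrees cut at one level pairwise disjoint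
(`FindBiclique.exists_cuts`). When they are treated in breadth-first order, all earlier ones lie
behind a single tree edge `ab` leaving the current subtree (`IsBFSOrdering.exists_separating_edge`).
Since a vertex lies in at most two cliques, nonadjacent vertices on opposite sides of `ab` lie in
`a` and `b` respectively, which leaves room for one of the two orientations of the merge
(`mergeable_of_separating_edge`).

For connected `Gᶜ` the clique tree is the intersection graph of the maximal cliques
(`IsCliqueTree.adj_iff`), hence unique. -/

namespace BicliqueCover

/-! ### Removing edges from trees, and edge-rankings. -/

section Trees

variable {W : Type*} {T : SimpleGraph W}

/-- A connected vertex set that does not contain both ends of an edge stays connected when the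
edge is deleted. -/
theorem reachable_deleteEdges_of_connected_induce {S : Set W} (hS : (T.induce S).Connected)
    {a b u w : W} (hu : u ∈ S) (hw : w ∈ S) (hab : ¬ (a ∈ S ∧ b ∈ S)) :
    (T.deleteEdges {s(a, b)}).Reachable u w := by
  let f : T.induce S →g T.deleteEdges {s(a, b)} :=
    ⟨Subtype.val, fun {x y} hxy => by
      rw [SimpleGraph.deleteEdges_adj]
      refine ⟨hxy, fun he => hab ?_⟩
      rcases Sym2.eq_iff.1 (Set.mem_singleton_iff.1 he) with ⟨h₁, h₂⟩ | ⟨h₁, h₂⟩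
      · exact ⟨h₁ ▸ x.2, h₂ ▸ y.2⟩
      · exact ⟨h₂ ▸ y.2, h₁ ▸ x.2⟩⟩
  exact (hS.preconnected ⟨u, hu⟩ ⟨w, hw⟩).map f

/-- A walk from `w` to `a` survives the deletion up to its first use of the edge, and there it
stands at `a` or `b`. -/
theorem reachable_deleteEdges_or (hT : T.Connected) (a b w : W) :
    (T.deleteEdges {s(a, b)}).Reachable a w ∨ (T.deleteEdges {s(a, b)}).Reachable b w := by
  obtain ⟨p⟩ := hT.preconnected w a
  induction p with
  | nil => exact Or.inl (SimpleGraph.Reachable.refl _)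
  | @cons u v c huv p ih =>
    by_cases he : s(u, v) = s(c, b)
    · rcases Sym2.eq_iff.1 he with ⟨rfl, -⟩ | ⟨rfl, -⟩
      · exact Or.inl (SimpleGraph.Reachable.refl _)
      · exact Or.inr (SimpleGraph.Reachable.refl _)
    · have hadj : (T.deleteEdges {s(c, b)}).Adj v u := by
        rw [SimpleGraph.deleteEdges_adj]
        exact ⟨huv.symm, fun h => he (Sym2.eq_swap.trans h)⟩
      exact ih.imp (fun h => h.trans hadj.reachable) (fun h => h.trans hadj.reachable)

/-- Every edge of an acyclic graph is a bridge; a walk avoiding it would reconnect its ends. -/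
theorem mem_edges_of_reachable_deleteEdges (hT : T.IsAcyclic) {a b w w' : W} (hab : T.Adj a b)
    (hw : (T.deleteEdges {s(a, b)}).Reachable a w)
    (hw' : (T.deleteEdges {s(a, b)}).Reachable b w') (p : T.Walk w w') : s(a, b) ∈ p.edges := by
  by_contra h
  refine SimpleGraph.isBridge_iff.1 (SimpleGraph.isAcyclic_iff_forall_adj_isBridge.1 hT hab) ?_
  refine (hw.trans ⟨p.toDeleteEdges {s(a, b)} ?_⟩).trans hw'.symm
  rintro e he rfl
  exact h he

/-- An edge of largest label inside a connected vertex set is the only one with its label. -/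
theorem IsEdgeRanking.eq_of_max {r : ℕ} {φ : Sym2 W → ℕ} (hφ : IsEdgeRanking T r φ) {S : Set W}
    (hS : (T.induce S).Connected) {a b c d : W} (ha : a ∈ S) (hab : T.Adj a b)
    (hmax : ∀ u ∈ S, ∀ v ∈ S, T.Adj u v → φ s(u, v) ≤ φ s(a, b))
    (hc : c ∈ S) (hcd : T.Adj c d) (heq : φ s(a, b) = φ s(c, d)) : s(a, b) = s(c, d) := by
  by_contra hne
  -- The path is taken inside `S`, so the larger label that the ranking demands on it contradicts
  -- maximality.
  obtain ⟨p, hp⟩ := hS.exists_isPath ⟨a, ha⟩ ⟨c, hc⟩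
  let f : T.induce S →g T := ⟨Subtype.val, fun h => h⟩
  obtain ⟨e, he, hlt⟩ := hφ.2 _ hab _ hcd hne heq a (by simp) c (by simp) (p.map f)
    (SimpleGraph.Walk.IsPath.map (f := f) Subtype.val_injective hp)
  rw [SimpleGraph.Walk.edges_map, List.mem_map] at he
  obtain ⟨e', he', rfl⟩ := he
  induction e' with
  | _ x y =>
    have hxy := p.adj_of_mem_edges he'
    exact absurd (hmax x x.2 y y.2 hxy) (not_le.2 hlt)

/-- Deleting an edge splits a connected vertex set of a tree into two connected parts. -/
theorem exists_split (hT : T.IsAcyclic) {S : Set W} (hS : (T.induce S).Connected) {a b : W}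
    (ha : a ∈ S) (hb : b ∈ S) (hab : T.Adj a b) :
    ∃ S₁ S₂ : Set W, S₁ ∪ S₂ = S ∧ Disjoint S₁ S₂ ∧ (T.induce S₁).Connected ∧
      (T.induce S₂).Connected ∧ a ∈ S₁ ∧ b ∈ S₂ := by
  classical
  -- The component of `c` in the subtree on `S` after the edge is removed, described by walks of
  -- `T`.
  let part : W → Set W := fun c =>
    {w | ∃ p : T.Walk c w, (∀ u ∈ p.support, u ∈ S) ∧ s(a, b) ∉ p.edges}
  have hself : ∀ c ∈ S, c ∈ part c := fun c hc => ⟨SimpleGraph.Walk.nil, by simpa using hc, by simp⟩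
  have hconn : ∀ c ∈ S, (T.induce (part c)).Connected := by
    intro c hc
    refine SimpleGraph.induce_connected_of_patches c (hself c hc) ?_
    rintro v ⟨p, hpS, hpe⟩
    refine ⟨{u | u ∈ p.support}, fun u hu => ⟨p.takeUntil u hu, fun x hx => ?_, fun he => ?_⟩,
      p.start_mem_support, p.end_mem_support, p.connected_induce_support.preconnected _ _⟩
    · exact hpS x (p.support_takeUntil_subset_support hu hx)
    · exact hpe (p.edges_takeUntil_subset_edges hu he)
  refine ⟨part a, part b, ?_, ?_, hconn a ha, hconn b hb, hself a ha, hself b hb⟩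
  · refine Set.Subset.antisymm ?_ ?_
    · rintro w (⟨p, hp, -⟩ | ⟨p, hp, -⟩) <;> exact hp w p.end_mem_support
    · have hstep : ∀ (u v : S) (_ : (T.induce S).Walk u v), (v : W) ∈ part a ∪ part b →
          (u : W) ∈ part a ∪ part b := by
        intro u v p
        induction p with
        | nil => exact id
        | @cons u v c huv p ih =>
          intro hc
          have huv' : T.Adj v u := SimpleGraph.Adj.symm huv
          by_cases he : s((u : W), (v : W)) = s(a, b)
          · rcases Sym2.eq_iff.1 he with ⟨h, -⟩ | ⟨h, -⟩
            · exact Or.inl (h ▸ hself a ha)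
            · exact Or.inr (h ▸ hself b hb)
          · have hext : ∀ c, (v : W) ∈ part c → (u : W) ∈ part c := by
              rintro c ⟨q, hqS, hqe⟩
              refine ⟨q.concat huv', fun x hx => ?_, fun hx => ?_⟩
              · rw [SimpleGraph.Walk.support_concat, List.mem_append, List.mem_singleton] at hx
                rcases hx with hx | rfl
                · exact hqS x hx
                · exact u.2
              · rw [SimpleGraph.Walk.edges_concat, List.concat_eq_append, List.mem_append,
                  List.mem_singleton] at hx
                rcases hx with hx | hx
                · exact hqe hx
                · exact he (Sym2.eq_swap.trans hx.symm)
            exact (ih hc).imp (hext a) (hext b)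
      intro w hw
      obtain ⟨p⟩ := hS.preconnected ⟨w, hw⟩ ⟨a, ha⟩
      exact hstep _ _ p (Or.inl (hself a ha))
  · rw [Set.disjoint_left]
    rintro w ⟨p, -, hp⟩ ⟨q, -, hq⟩
    have := SimpleGraph.isBridge_iff_forall_walk_mem_edges.1
      (SimpleGraph.isAcyclic_iff_forall_adj_isBridge.1 hT hab) (p.append q.reverse)
    rw [SimpleGraph.Walk.edges_append, SimpleGraph.Walk.edges_reverse, List.mem_append,
      List.mem_reverse] at this
    exact this.elim hp hq

/-- Every finite graph has an edge-ranking, so the optimal number of ranks is attained. -/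
theorem exists_isEdgeRanking_edgeRankingNumber [Finite W] (T : SimpleGraph W) :
    ∃ φ : Sym2 W → ℕ, IsEdgeRanking T (edgeRankingNumber T) φ := by
  refine Nat.sInf_mem (s := {r : ℕ | ∃ φ : Sym2 W → ℕ, IsEdgeRanking T r φ}) ?_
  -- Pairwise distinct labels make the separation condition vacuous; the shift by one keeps them
  -- positive.
  let f := Finite.equivFin (Sym2 W)
  refine ⟨Nat.card (Sym2 W), fun e => (f e : ℕ) + 1, fun e _ => ⟨Nat.le_add_left _ _, (f e).2⟩, ?_⟩
  intro e₁ _ e₂ _ hne heq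
  exact absurd (f.injective (Fin.ext (Nat.succ_injective heq))) hne

end Trees

/-! ### Breadth-first orderings. -/

section BreadthFirst

variable {W : Type*} {T : SimpleGraph W}

/-- Here `n` is fuel: each step moves a vertex into `seen`, and once `seen` has as many entries as
`W` the absence of repetitions empties the queue. -/
theorem BFS.exists_of_nodup [Finite W] (T : SimpleGraph W) :
    ∀ (n : ℕ) (queue seen : List W), (seen ++ queue).Nodup → Nat.card W ≤ n + seen.length →
      ∃ out, BFS T queue seen out := by
  classical
  have := Fintype.ofFinite W
  intro n
  induction n with
  | zero =>
    intro queue seen hnd hcard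
    have hlen := hnd.length_le_card
    rw [List.length_append, ← Nat.card_eq_fintype_card] at hlen
    obtain rfl : queue = [] := List.length_eq_zero_iff.1 (by omega)
    exact ⟨seen, BFS.finish seen⟩
  | succ n ih =>
    intro queue seen hnd hcard
    cases queue with
    | nil => exact ⟨seen, BFS.finish seen⟩
    | cons v queue =>
      let new := (Finset.univ.filter
        fun w => T.Adj v w ∧ w ∉ v :: queue ∧ w ∉ seen).toList
      have hnew : ∀ w, w ∈ new ↔ T.Adj v w ∧ w ∉ v :: queue ∧ w ∉ seen := by simp [new]
      obtain ⟨out, hout⟩ := ih (queue ++ new) (seen ++ [v]) (by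
        have : seen ++ [v] ++ (queue ++ new) = (seen ++ v :: queue) ++ new := by simp
        rw [this, List.nodup_append']
        refine ⟨hnd, Finset.nodup_toList _, fun w hw hw' => ?_⟩
        have := (hnew w).1 hw'
        rcases List.mem_append.1 hw with h | h
        exacts [this.2.2 h, this.2.1 h]) (by
          rw [List.length_append, List.length_singleton]; omega)
      exact ⟨out, BFS.step v queue seen new out (Finset.nodup_toList _) hnew hout⟩

-- The list `seen ++ queue` only grows at its end, so positions never change and a discovered vertex
-- comes after the vertex that discovered it.
open Classical in
theorem BFS.spec {ρ : W} {queue seen out : List W} (h : BFS T queue seen out)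
    (hρ : ρ ∈ seen ++ queue)
    (hclosed : ∀ v ∈ seen, ∀ w, T.Adj v w → w ∈ seen ++ queue)
    (hparent : ∀ w ∈ seen ++ queue, w ≠ ρ →
      ∃ w', T.Adj w w' ∧ (seen ++ queue).idxOf w' < (seen ++ queue).idxOf w) :
    ρ ∈ out ∧ (∀ v ∈ out, ∀ w, T.Adj v w → w ∈ out) ∧
      ∀ w ∈ out, w ≠ ρ → ∃ w', T.Adj w w' ∧ out.idxOf w' < out.idxOf w := by
  induction h with
  | finish out =>
    rw [List.append_nil] at hρ hclosed hparent
    exact ⟨hρ, hclosed, hparent⟩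
  | step v queue seen new out hnd hnew hrest ih =>
    have hassoc : seen ++ [v] ++ (queue ++ new) = (seen ++ v :: queue) ++ new := by simp
    rw [hassoc] at ih
    have hv : v ∈ seen ++ v :: queue := by simp
    refine ih (List.mem_append_left _ hρ) ?_ ?_
    · intro u hu w huw
      rcases List.mem_append.1 hu with hu | hu
      · exact List.mem_append_left _ (hclosed u hu w huw)
      · obtain rfl := List.mem_singleton.1 hu
        by_cases hw : w ∈ seen ++ u :: queue
        · exact List.mem_append_left _ hw
        · refine List.mem_append_right _ ((hnew w).2 ⟨huw, ?_, ?_⟩)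
          · exact fun h => hw (List.mem_append_right _ h)
          · exact fun h => hw (List.mem_append_left _ h)
    · intro w hw hwρ
      by_cases hold : w ∈ seen ++ v :: queue
      · obtain ⟨w', hadj, hlt⟩ := hparent w hold hwρ
        have hw' : w' ∈ seen ++ v :: queue :=
          List.idxOf_lt_length_iff.1 (hlt.trans (List.idxOf_lt_length_iff.2 hold))
        refine ⟨w', hadj, ?_⟩
        rwa [List.idxOf_append_of_mem hold, List.idxOf_append_of_mem hw']
      · have hwnew : w ∈ new := (List.mem_append.1 hw).resolve_left hold
        refine ⟨v, ((hnew w).1 hwnew).1.symm, ?_⟩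
        rw [List.idxOf_append_of_mem hv, List.idxOf_append_of_notMem hold]
        exact (List.idxOf_lt_length_iff.2 hv).trans_le (Nat.le_add_right _ _)

/-- A breadth-first ordering of a connected graph is injective, and every vertex but the root has
an earlier neighbour. -/
theorem IsBFSOrdering.spec (hT : T.Connected) {σ : W → ℕ} (hσ : IsBFSOrdering T σ) :
    Function.Injective σ ∧ ∃ ρ, ∀ w, w ≠ ρ → ∃ w', T.Adj w w' ∧ σ w' < σ w := by
  classical
  obtain ⟨ρ, out, -, hbfs, hσ⟩ := hσ
  obtain ⟨hρ, hclosed, hparent⟩ := hbfs.spec (ρ := ρ) (by simp) (by simp)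
    (fun w hw hne => absurd (by simpa using hw) hne)
  -- Unlisted vertices would all share the default index `out.length`, so injectivity needs every
  -- vertex to be listed.
  have hall : ∀ w, w ∈ out := by
    intro w
    obtain ⟨p⟩ := hT.preconnected w ρ
    induction p with
    | nil => exact hρ
    | cons h p ih => exact hclosed _ (ih hbfs hρ hparent) _ h.symm
  refine ⟨fun w w' h => ?_, ρ, fun w hw => ?_⟩
  · rw [hσ, hσ] at h
    exact (List.idxOf_inj (hall w)).1 (Nat.succ_injective h)
  · obtain ⟨w', hadj, hlt⟩ := hparent w (hall w) hw
    refine ⟨w', hadj, ?_⟩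
    rw [hσ, hσ]
    omega

theorem exists_isBFSOrdering [Finite W] (hT : T.IsTree) : ∃ σ, IsBFSOrdering T σ := by
  classical
  have := Fintype.ofFinite W
  have hleaf : ∃ ρ, (T.neighborSet ρ).Subsingleton := by
    rcases subsingleton_or_nontrivial W with h | h
    · obtain ⟨ρ⟩ := hT.connected.nonempty
      exact ⟨ρ, Set.subsingleton_of_subsingleton⟩
    · obtain ⟨ρ, hρ⟩ := hT.exists_vert_degree_one_of_nontrivial
      obtain ⟨w, -, hw⟩ := SimpleGraph.degree_eq_one_iff_existsUnique_adj.1 hρ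
      exact ⟨ρ, fun x hx y hy => (hw x hx).trans (hw y hy).symm⟩
  obtain ⟨ρ, hρ⟩ := hleaf
  obtain ⟨out, hout⟩ := BFS.exists_of_nodup T (Nat.card W) [ρ] [] (by simp) (by simp)
  exact ⟨fun w => out.idxOf w + 1, ρ, out, hρ, hout, fun w => rfl⟩

/-- The connected sets that precede a connected set `S` in the ordering all lie behind a single
edge that leaves `S`. -/
theorem IsBFSOrdering.exists_separating_edge (hT : T.Connected) {σ : W → ℕ}
    (hσ : IsBFSOrdering T σ) {S : Set W} (hS : S.Nonempty) {w₀ : W}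
    (hw₀ : σ w₀ < sInf (σ '' S)) :
    ∃ a ∈ S, ∃ b ∉ S, T.Adj a b ∧
      ∀ w, σ w < sInf (σ '' S) → (T.deleteEdges {s(a, b)}).Reachable b w := by
  obtain ⟨-, ρ, hρ⟩ := hσ.spec hT
  -- The separating edge joins the earliest vertex `a` of `S` to an earlier neighbour `b`, which
  -- therefore lies outside `S`.
  obtain ⟨a, haS, ha⟩ := Nat.sInf_mem (hS.image σ)
  rw [← ha] at hw₀ ⊢
  have hmin : ∀ n w, σ w = n → σ ρ ≤ n := by
    intro n
    induction n using Nat.strong_induction_on with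
    | _ n ih =>
      rintro w rfl
      by_cases hw : w = ρ
      · rw [hw]
      · obtain ⟨w', -, hlt⟩ := hρ w hw
        exact (ih _ hlt w' rfl).trans hlt.le
  have haρ : a ≠ ρ := by
    rintro rfl
    exact absurd (hmin _ w₀ rfl) (not_le.2 hw₀)
  obtain ⟨b, hab, hlt⟩ := hρ a haρ
  -- Descending through earlier neighbours from a vertex before `a` reaches the root without
  -- visiting `a`, hence without using the edge.
  have hroot : ∀ n w, σ w = n → n < σ a → (T.deleteEdges {s(a, b)}).Reachable w ρ := by
    intro n
    induction n using Nat.strong_induction_on with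
    | _ n ih =>
      rintro w rfl hwa
      by_cases hw : w = ρ
      · rw [hw]
      · obtain ⟨w', hadj, hlt'⟩ := hρ w hw
        refine SimpleGraph.Reachable.trans (SimpleGraph.Adj.reachable ?_)
          (ih _ hlt' w' rfl (hlt'.trans hwa))
        rw [SimpleGraph.deleteEdges_adj]
        refine ⟨hadj, fun he => ?_⟩
        rcases Sym2.eq_iff.1 (Set.mem_singleton_iff.1 he) with ⟨rfl, -⟩ | ⟨-, rfl⟩
        · exact lt_irrefl _ hwa
        · exact lt_asymm hlt' hwa
  refine ⟨a, haS, b, fun hb => ?_, hab, fun w hw => ?_⟩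
  · have := Nat.sInf_le (Set.mem_image_of_mem σ hb)
    omega
  · exact (hroot _ b rfl hlt).trans (hroot _ w rfl hw).symm

end BreadthFirst

/-! ### Maximal cliques of the complement and the lower bound. -/

section Cliques

variable {V : Type*} {G : SimpleGraph V}

theorem not_adj_of_mem_maxClique (K : MaxClique Gᶜ) {x y : V} (hx : x ∈ K.1) (hy : y ∈ K.1) :
    ¬ G.Adj x y := fun h => ((K.2.prop hx hy h.ne) : Gᶜ.Adj x y).2 h

/-- Two vertices are adjacent in `G` if and only if no maximal clique of `Gᶜ` contains both. -/
theorem adj_iff_forall_maxClique [Finite V] {x y : V} :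
    G.Adj x y ↔ ∀ K : MaxClique Gᶜ, x ∈ K.1 → y ∉ K.1 := by
  refine ⟨fun h K hx hy => not_adj_of_mem_maxClique K hx hy h, fun h => ?_⟩
  by_contra hadj
  have hclique : Gᶜ.IsClique {x, y} := by
    rw [SimpleGraph.isClique_pair]
    exact fun hne => ⟨hne, hadj⟩
  obtain ⟨K, hle, hK⟩ := Finite.exists_le_maximal hclique
  exact h ⟨K, hK⟩ (hle (by simp)) (hle (by simp))

theorem exists_mem_maxClique [Finite V] (H : SimpleGraph V) {x y : V} (h : H.Adj x y) :
    ∃ K : MaxClique H, x ∈ K.1 ∧ y ∈ K.1 := by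
  have hclique : H.IsClique {x, y} := by
    rw [SimpleGraph.isClique_pair]
    exact fun _ => h
  obtain ⟨K, hle, hK⟩ := Finite.exists_le_maximal hclique
  exact ⟨⟨K, hK⟩, hle (by simp), hle (by simp)⟩

theorem mem_cliqueUnion {H : SimpleGraph V} {S : Set (MaxClique H)} {x : V} :
    x ∈ cliqueUnion S ↔ ∃ K ∈ S, x ∈ K.1 := by
  simp only [cliqueUnion, Set.mem_iUnion, exists_prop]

theorem MaxClique.exists_mem_notMem {H : SimpleGraph V} {K K' : MaxClique H} (h : K ≠ K') :
    ∃ x ∈ K.1, x ∉ K'.1 := by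
  by_contra! hsub
  exact h (Subtype.ext (K.2.eq_of_subset K'.2.prop hsub))

theorem isBiclique_of_adj {L R : Set V} (hL : L.Nonempty) (hR : R.Nonempty)
    (h : ∀ u ∈ L, ∀ v ∈ R, G.Adj u v) : IsBiclique G L R :=
  ⟨hL, hR, Set.disjoint_left.2 fun x hx hx' => (h x hx x hx').ne rfl, h⟩

theorem IsBiclique.symm {L R : Set V} (h : IsBiclique G L R) : IsBiclique G R L :=
  ⟨h.2.1, h.1, h.2.2.1.symm, fun u hu v hv => (h.2.2.2 v hv u hu).symm⟩

/-- A biclique cover of size `k` tells at most `2 ^ k` maximal independent sets apart. -/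
theorem IsBicliqueCover.mc_le [Finite V] {C : Set (Sym2 (Set V))} (hC : IsBicliqueCover G C) :
    mc Gᶜ ≤ 2 ^ C.ncard := by
  classical
  -- `Quot.out` chooses a side of each unordered biclique.
  let f : MaxClique Gᶜ → 𝒫 C := fun K =>
    ⟨{B | B ∈ C ∧ (K.1 ∩ (Quot.out B).1).Nonempty}, fun B hB => hB.1⟩
  have hf : Function.Injective f := by
    intro I J hIJ
    by_contra hne
    have hmem : ∀ B, B ∈ C → ((I.1 ∩ (Quot.out B).1).Nonempty ↔ (J.1 ∩ (Quot.out B).1).Nonempty) := by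
      intro B hB
      have := congrArg (fun s : 𝒫 C => B ∈ s.1) hIJ
      simpa [f, hB] using this
    obtain ⟨u, huI, huJ⟩ := MaxClique.exists_mem_notMem hne
    -- Otherwise `J` could be enlarged by `u`.
    have hex : ∃ v ∈ J.1, G.Adj u v := by
      by_contra! hno
      refine huJ (J.2.mem_of_prop_insert (SimpleGraph.IsClique.insert J.2.prop ?_))
      exact fun v hv hne' => ⟨hne', hno v hv⟩
    obtain ⟨v, hvJ, huv⟩ := hex
    obtain ⟨L, R, hLR, hu, hv⟩ := hC.2 u v huv
    have hbi := hC.1 L R hLR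
    have hiff := hmem _ hLR
    have hout : s((Quot.out s(L, R)).1, (Quot.out s(L, R)).2) = s(L, R) := Quot.out_eq s(L, R)
    -- Whichever side was chosen, equal images make `I` or `J` meet both sides, which is impossible
    -- for an independent set of `G`.
    rcases Sym2.eq_iff.1 hout with ⟨h₁, -⟩ | ⟨h₁, -⟩
    · rw [h₁] at hiff
      obtain ⟨w, hwJ, hwL⟩ := hiff.1 ⟨u, huI, hu⟩
      exact not_adj_of_mem_maxClique J hwJ hvJ (hbi.2.2.2 w hwL v hv)
    · rw [h₁] at hiff
      obtain ⟨w, hwI, hwR⟩ := hiff.2 ⟨v, hvJ, hv⟩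
      exact not_adj_of_mem_maxClique I huI hwI (hbi.2.2.2 u hu w hwR)
  calc mc Gᶜ ≤ Nat.card (𝒫 C) := Nat.card_le_card_of_injective f hf
    _ = 2 ^ C.ncard := by rw [Nat.card_coe_set_eq, Set.ncard_powerset]

theorem IsBicliqueCover.ceil_logb_mc_le [Finite V] {C : Set (Sym2 (Set V))}
    (hC : IsBicliqueCover G C) : ⌈Real.logb 2 (mc Gᶜ)⌉₊ ≤ C.ncard := by
  -- This also covers empty `V`, where the empty set is a maximal clique.
  have hpos : 0 < mc Gᶜ := by
    obtain ⟨K, -, hK⟩ := Finite.exists_le_maximal (Gᶜ.isClique_empty)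
    have : Nonempty (MaxClique Gᶜ) := ⟨⟨K, hK⟩⟩
    exact Nat.card_pos
  rw [Nat.ceil_le, Real.logb_le_iff_le_rpow one_lt_two (by exact_mod_cast hpos),
    Real.rpow_natCast]
  exact_mod_cast hC.mc_le

end Cliques

/-! ### Clique trees when every vertex lies in at most two cliques. -/

section CliqueTrees

variable {V : Type*} {H : SimpleGraph V} {T : SimpleGraph (MaxClique H)}

/-- Every vertex lies in at most two maximal cliques. -/
def AtMostTwoCliques (H : SimpleGraph V) : Prop :=
  ∀ (v : V) (K₁ K₂ K₃ : MaxClique H), v ∈ K₁.1 → v ∈ K₂.1 → v ∈ K₃.1 →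
    K₁ = K₂ ∨ K₁ = K₃ ∨ K₂ = K₃

theorem atMostTwoCliques_compl [Finite V] {G : SimpleGraph V}
    (htwo : ∀ v : V, {I : Set V | Maximal G.IsIndepSet I ∧ v ∈ I}.ncard ≤ 2) :
    AtMostTwoCliques Gᶜ := by
  intro v K₁ K₂ K₃ h₁ h₂ h₃
  by_contra! hne
  have hmem : ∀ K : MaxClique Gᶜ, v ∈ K.1 →
      K.1 ∈ {I : Set V | Maximal G.IsIndepSet I ∧ v ∈ I} := by
    intro K hK
    refine ⟨?_, hK⟩
    exact ⟨G.isClique_compl.1 K.2.prop, fun I hI => K.2.le_of_ge (G.isClique_compl.2 hI)⟩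
  have hlt : 2 < {I : Set V | Maximal G.IsIndepSet I ∧ v ∈ I}.ncard := by
    rw [Set.two_lt_ncard (Set.toFinite _)]
    exact ⟨K₁.1, hmem K₁ h₁, K₂.1, hmem K₂ h₂, K₃.1, hmem K₃ h₃,
      fun h => hne.1 (Subtype.ext h), fun h => hne.2.1 (Subtype.ext h),
      fun h => hne.2.2 (Subtype.ext h)⟩
  exact absurd (htwo v) (not_le.2 hlt)

/-- The path from `w` to `w'` crosses the edge, so the clique-intersection property applies to both
its ends. -/
theorem IsCliqueTree.inter_subset (hT : IsCliqueTree H T) {a b w w' : MaxClique H}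
    (hab : T.Adj a b) (hw : (T.deleteEdges {s(a, b)}).Reachable a w)
    (hw' : (T.deleteEdges {s(a, b)}).Reachable b w') {x : V} (hx : x ∈ w.1) (hx' : x ∈ w'.1) :
    x ∈ a.1 ∧ x ∈ b.1 := by
  obtain ⟨p, hp⟩ := hT.1.connected.exists_isPath w w'
  have he := mem_edges_of_reachable_deleteEdges hT.1.isAcyclic hab hw hw' p
  exact ⟨hT.2 w w' p hp a (p.fst_mem_support_of_mem_edges he) ⟨hx, hx'⟩,
    hT.2 w w' p hp b (p.snd_mem_support_of_mem_edges he) ⟨hx, hx'⟩⟩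

/-- If adjacent cliques were disjoint, deleting their edge would also disconnect `H`. Conversely, a
common vertex lies in every clique on the path between the two, which leaves no room for a third
clique. The right side does not mention `T`, so this gives uniqueness of the clique tree. -/
theorem IsCliqueTree.adj_iff [Finite V] (hT : IsCliqueTree H T) (h2 : AtMostTwoCliques H)
    (hH : H.Connected) (K K' : MaxClique H) :
    T.Adj K K' ↔ K ≠ K' ∧ (K.1 ∩ K'.1).Nonempty := by
  constructor
  · intro hadj
    refine ⟨hadj.ne, ?_⟩
    by_contra hempty
    have hside : ∀ x y, H.Walk x y →
        (∃ A : MaxClique H, (T.deleteEdges {s(K, K')}).Reachable K A ∧ x ∈ A.1) →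
        ∃ A : MaxClique H, (T.deleteEdges {s(K, K')}).Reachable K A ∧ y ∈ A.1 := by
      intro x y p
      induction p with
      | nil => exact id
      | cons h p ih =>
        rintro ⟨A, hA, hxA⟩
        obtain ⟨B, hxB, hyB⟩ := exists_mem_maxClique H h
        rcases reachable_deleteEdges_or hT.1.connected K K' B with hB | hB
        · exact ih ⟨B, hB, hyB⟩
        · exact absurd ⟨_, hT.inter_subset hadj hA hB hxA hxB⟩ hempty
    obtain ⟨x, hx, -⟩ := MaxClique.exists_mem_notMem hadj.ne
    obtain ⟨y, hy, -⟩ := MaxClique.exists_mem_notMem hadj.ne'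
    obtain ⟨p⟩ := hH.preconnected x y
    obtain ⟨A, hA, hyA⟩ := hside x y p ⟨K, SimpleGraph.Reachable.refl _, hx⟩
    exact hempty ⟨y, hT.inter_subset hadj hA (SimpleGraph.Reachable.refl _) hyA hy⟩
  · rintro ⟨hne, v, hvK, hvK'⟩
    obtain ⟨p, hp⟩ := hT.1.connected.exists_isPath K K'
    have hsub := hT.2 K K' p hp
    cases p with
    | nil => exact absurd rfl hne
    | @cons _ A _ h q =>
      have hvA : v ∈ A.1 := hsub A (by simp) ⟨hvK, hvK'⟩
      rcases h2 v K A K' hvK hvA hvK' with h' | h' | h'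
      · exact absurd h' h.ne
      · exact absurd h' hne
      · exact h' ▸ h

/-- If a vertex of a clique on one side of a tree edge and a vertex of a clique on the other side
share a clique, then they lie in the respective ends of the edge. -/
theorem IsCliqueTree.mem_ends_of_share (hT : IsCliqueTree H T) (h2 : AtMostTwoCliques H)
    {a b A B K : MaxClique H} (hab : T.Adj a b)
    (hA : (T.deleteEdges {s(a, b)}).Reachable a A) (hB : (T.deleteEdges {s(a, b)}).Reachable b B)
    {x y : V} (hx : x ∈ A.1) (hy : y ∈ B.1) (hxK : x ∈ K.1) (hyK : y ∈ K.1) :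
    x ∈ a.1 ∧ y ∈ b.1 := by
  have hnot := SimpleGraph.isBridge_iff.1
    (SimpleGraph.isAcyclic_iff_forall_adj_isBridge.1 hT.1.isAcyclic hab)
  -- If `K` is on the side of `a`, then `y` lies in `a`, `b` and `K`, which forces `K = a`; the
  -- other side is symmetric.
  rcases reachable_deleteEdges_or hT.1.connected a b K with hK | hK
  · obtain ⟨hya, hyb⟩ := hT.inter_subset hab hK hB hyK hy
    rcases h2 y a b K hya hyb hyK with h | h | h
    · exact absurd h hab.ne
    · exact ⟨h ▸ hxK, hyb⟩
    · exact absurd (h ▸ hK) hnot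
  · obtain ⟨hxa, hxb⟩ := hT.inter_subset hab hA hK hx hxK
    rcases h2 x a b K hxa hxb hxK with h | h | h
    · exact absurd h hab.ne
    · exact absurd (h.symm ▸ hK.symm : (T.deleteEdges {s(a, b)}).Reachable a b) hnot
    · exact ⟨hxa, h ▸ hyK⟩

end CliqueTrees

/-! ### The recursive cuts and their levels. -/

section Cuts

variable {V : Type*} {H : SimpleGraph V}

/-- The entry `E` arises when the subtree with vertex set `S` is cut at one of its edges. -/
def IsCut (T : SimpleGraph (MaxClique H)) (σ : MaxClique H → ℕ) (S : Set (MaxClique H))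
    (E : Entry V) : Prop :=
  (T.induce S).Connected ∧ ∃ (S₁ S₂ : Set (MaxClique H)) (K₁ K₂ : MaxClique H),
    S₁ ∪ S₂ = S ∧ Disjoint S₁ S₂ ∧ (T.induce S₁).Connected ∧ (T.induce S₂).Connected ∧
      K₁ ∈ S₁ ∧ K₂ ∈ S₂ ∧ T.Adj K₁ K₂ ∧
      E = ((cliqueUnion S₁ \ (K₁.1 ∩ K₂.1), cliqueUnion S₂ \ (K₁.1 ∩ K₂.1)), sInf (σ '' S))

variable {T : SimpleGraph (MaxClique H)} {φ : Sym2 (MaxClique H) → ℕ} {σ : MaxClique H → ℕ} {r : ℕ}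

theorem IsCut.subset {S : Set (MaxClique H)} {E : Entry V} (h : IsCut T σ S E) :
    E.1.1 ∪ E.1.2 ⊆ cliqueUnion S := by
  obtain ⟨-, S₁, S₂, K₁, K₂, rfl, -, -, -, -, -, -, rfl⟩ := h
  rintro x (hx | hx)
  · obtain ⟨K, hK, hxK⟩ := mem_cliqueUnion.1 hx.1
    exact mem_cliqueUnion.2 ⟨K, Or.inl hK, hxK⟩
  · obtain ⟨K, hK, hxK⟩ := mem_cliqueUnion.1 hx.1
    exact mem_cliqueUnion.2 ⟨K, Or.inr hK, hxK⟩

/-- The entries of one level come from cuts of pairwise disjoint subtrees. -/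
theorem FindBiclique.exists_cuts (hφ : IsEdgeRanking T r φ) {S : Set (MaxClique H)}
    {d : ℕ → List (Entry V)} (h : FindBiclique T φ σ r S d) (hS : (T.induce S).Connected) (i : ℕ) :
    ∃ ps : List (Set (MaxClique H) × Entry V), ps.map Prod.snd = d i ∧
      (∀ p ∈ ps, p.1 ⊆ S ∧ IsCut T σ p.1 p.2 ∧
        ∃ K ∈ S, ∃ K' ∈ S, T.Adj K K' ∧ i = r + 1 - φ s(K, K')) ∧
      ps.Pairwise fun p q => Disjoint p.1 q.1 := by
  induction h with
  | small S _ => exact ⟨[], rfl, by simp, List.Pairwise.nil⟩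
  | cut S S₁ S₂ K₁ K₂ d₁ d₂ hnt hunion hdisj hconn₁ hconn₂ hK₁ hK₂ hadj hmax _ _ ih₁ ih₂ =>
    have hsub₁ : S₁ ⊆ S := hunion ▸ Set.subset_union_left
    have hsub₂ : S₂ ⊆ S := hunion ▸ Set.subset_union_right
    obtain ⟨ps₁, hmap₁, hcut₁, hpw₁⟩ := ih₁ hconn₁
    obtain ⟨ps₂, hmap₂, hcut₂, hpw₂⟩ := ih₂ hconn₂
    have hpw : (ps₁ ++ ps₂).Pairwise fun p q => Disjoint p.1 q.1 :=
      List.pairwise_append.2 ⟨hpw₁, hpw₂, fun p hp q hq =>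
        hdisj.mono (hcut₁ p hp).1 (hcut₂ q hq).1⟩
    -- The largest label in `S` occurs only once, so at its level both recursive calls contribute
    -- nothing.
    by_cases hi : i = r + 1 - φ s(K₁, K₂)
    · have hunique : ∀ K ∈ S, ∀ K', T.Adj K K' → i = r + 1 - φ s(K, K') →
          s(K₁, K₂) = s(K, K') := by
        intro K hK K' hKK' hi'
        refine hφ.eq_of_max hS (hsub₁ hK₁) hadj hmax hK hKK' ?_
        -- Labels are at most `r`, so the truncated subtraction loses nothing and equal levels mean
        -- equal labels.
        have h₁ := hφ.1 s(K₁, K₂) hadj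
        have h₂ := hφ.1 s(K, K') hKK'
        omega
      have hnil₁ : ps₁ = [] := by
        refine List.eq_nil_iff_forall_not_mem.2 fun p hp => ?_
        obtain ⟨-, -, K, hK, K', hK', hKK', hi'⟩ := hcut₁ p hp
        have hmem : K₂ ∈ s(K, K') := hunique K (hsub₁ hK) K' hKK' hi' ▸ Sym2.mem_mk_right _ _
        rcases Sym2.mem_iff.1 hmem with rfl | rfl
        · exact Set.disjoint_left.1 hdisj hK hK₂
        · exact Set.disjoint_left.1 hdisj hK' hK₂
      have hnil₂ : ps₂ = [] := by
        refine List.eq_nil_iff_forall_not_mem.2 fun p hp => ?_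
        obtain ⟨-, -, K, hK, K', hK', hKK', hi'⟩ := hcut₂ p hp
        have hmem : K₁ ∈ s(K, K') := hunique K (hsub₂ hK) K' hKK' hi' ▸ Sym2.mem_mk_left _ _
        rcases Sym2.mem_iff.1 hmem with rfl | rfl
        · exact Set.disjoint_left.1 hdisj hK₁ hK
        · exact Set.disjoint_left.1 hdisj hK₁ hK'
      refine ⟨[(S, ((cliqueUnion S₁ \ (K₁.1 ∩ K₂.1), cliqueUnion S₂ \ (K₁.1 ∩ K₂.1)),
        sInf (σ '' S)))], ?_, ?_, List.pairwise_singleton _ _⟩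
      · beta_reduce
        rw [← hmap₁, ← hmap₂, hnil₁, hnil₂, if_pos hi]
        rfl
      · intro p hp
        obtain rfl := List.mem_singleton.1 hp
        exact ⟨subset_rfl, ⟨hS, S₁, S₂, K₁, K₂, hunion, hdisj, hconn₁, hconn₂, hK₁, hK₂, hadj, rfl⟩,
          K₁, hsub₁ hK₁, K₂, hsub₂ hK₂, hadj, hi⟩
    · refine ⟨ps₁ ++ ps₂, ?_, ?_, hpw⟩
      · beta_reduce
        rw [if_neg hi, List.map_append, hmap₁, hmap₂, List.nil_append]
      · intro p hp
        rcases List.mem_append.1 hp with hp | hp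
        · obtain ⟨hsub, hcut, K, hK, K', hK', hrest⟩ := hcut₁ p hp
          exact ⟨hsub.trans hsub₁, hcut, K, hsub₁ hK, K', hsub₁ hK', hrest⟩
        · obtain ⟨hsub, hcut, K, hK, K', hK', hrest⟩ := hcut₂ p hp
          exact ⟨hsub.trans hsub₂, hcut, K, hsub₂ hK, K', hsub₂ hK', hrest⟩

/-- Vertices of cliques of the current subtree that share no clique are separated by an entry. -/
theorem FindBiclique.exists_entry (hφ : IsEdgeRanking T r φ) {S : Set (MaxClique H)}
    {d : ℕ → List (Entry V)} (h : FindBiclique T φ σ r S d) {u v : V}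
    (huv : ∀ K : MaxClique H, u ∈ K.1 → v ∉ K.1) (hu : u ∈ cliqueUnion S)
    (hv : v ∈ cliqueUnion S) :
    ∃ i ∈ Set.Icc 1 r, ∃ E ∈ d i, (u ∈ E.1.1 ∧ v ∈ E.1.2) ∨ (v ∈ E.1.1 ∧ u ∈ E.1.2) := by
  induction h with
  | small S hS =>
    obtain ⟨K, hK, huK⟩ := mem_cliqueUnion.1 hu
    obtain ⟨K', hK', hvK⟩ := mem_cliqueUnion.1 hv
    exact absurd (hS hK' hK ▸ hvK) (huv K huK)
  | cut S S₁ S₂ K₁ K₂ d₁ d₂ hnt hunion hdisj hconn₁ hconn₂ hK₁ hK₂ hadj hmax _ _ ih₁ ih₂ =>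
    have hor : ∀ x ∈ cliqueUnion S, x ∈ cliqueUnion S₁ ∨ x ∈ cliqueUnion S₂ := by
      intro x hx
      obtain ⟨K, hK, hxK⟩ := mem_cliqueUnion.1 hx
      rw [← hunion] at hK
      exact hK.imp (fun h => mem_cliqueUnion.2 ⟨K, h, hxK⟩) (fun h => mem_cliqueUnion.2 ⟨K, h, hxK⟩)
    by_cases h₁ : u ∈ cliqueUnion S₁ ∧ v ∈ cliqueUnion S₁
    · obtain ⟨i, hi, E, hE, hmem⟩ := ih₁ h₁.1 h₁.2
      exact ⟨i, hi, E, by simp [hE], hmem⟩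
    by_cases h₂ : u ∈ cliqueUnion S₂ ∧ v ∈ cliqueUnion S₂
    · obtain ⟨i, hi, E, hE, hmem⟩ := ih₂ h₂.1 h₂.2
      exact ⟨i, hi, E, by simp [hE], hmem⟩
    have hrange := hφ.1 s(K₁, K₂) hadj
    refine ⟨r + 1 - φ s(K₁, K₂), ⟨by omega, by omega⟩, _, List.mem_append_left _
      (List.mem_append_left _ (by rw [if_pos rfl]; exact List.mem_singleton_self _)), ?_⟩
    -- A vertex of the removed intersection belongs to both halves, which would put `u` and `v`
    -- together in one half.
    have hin₁ : ∀ x, x ∈ K₁.1 ∩ K₂.1 → x ∈ cliqueUnion S₁ := fun x hx =>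
      mem_cliqueUnion.2 ⟨K₁, hK₁, hx.1⟩
    have hin₂ : ∀ x, x ∈ K₁.1 ∩ K₂.1 → x ∈ cliqueUnion S₂ := fun x hx =>
      mem_cliqueUnion.2 ⟨K₂, hK₂, hx.2⟩
    rcases hor u hu with hu' | hu' <;> rcases hor v hv with hv' | hv'
    · exact absurd ⟨hu', hv'⟩ h₁
    · exact Or.inl ⟨⟨hu', fun h => h₂ ⟨hin₂ u h, hv'⟩⟩, hv', fun h => h₁ ⟨hu', hin₁ v h⟩⟩
    · exact Or.inr ⟨⟨hv', fun h => h₂ ⟨hu', hin₂ v h⟩⟩, hu', fun h => h₁ ⟨hin₁ u h, hv'⟩⟩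
    · exact absurd ⟨hu', hv'⟩ h₂

theorem FindBiclique.exists_of_connected [Finite V] (hT : T.IsAcyclic) (φ : Sym2 (MaxClique H) → ℕ)
    (σ : MaxClique H → ℕ) (r : ℕ) :
    ∀ (n : ℕ) (S : Set (MaxClique H)), S.ncard = n → (T.induce S).Connected →
      ∃ d, FindBiclique T φ σ r S d := by
  intro n
  induction n using Nat.strong_induction_on with
  | _ n ih =>
    rintro S rfl hS
    rcases S.subsingleton_or_nontrivial with hsub | hnt
    · exact ⟨_, FindBiclique.small S hsub⟩
    let edges : Set (MaxClique H × MaxClique H) := {e | e.1 ∈ S ∧ e.2 ∈ S ∧ T.Adj e.1 e.2}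
    have hne : edges.Nonempty := by
      have : Nontrivial S := hnt.coe_sort
      obtain ⟨u⟩ := hS.nonempty
      obtain ⟨v, huv⟩ := hS.preconnected.exists_adj_of_nontrivial u
      exact ⟨(u, v), u.2, v.2, huv⟩
    obtain ⟨⟨K₁, K₂⟩, ⟨h₁, h₂, hadj⟩, hmax⟩ :=
      Set.exists_max_image edges (fun e => φ s(e.1, e.2)) (Set.toFinite _) hne
    obtain ⟨S₁, S₂, hunion, hdisj, hconn₁, hconn₂, hK₁, hK₂⟩ := exists_split hT hS h₁ h₂ hadj
    have hlt₁ : S₁.ncard < S.ncard := Set.ncard_lt_ncard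
      ⟨hunion ▸ Set.subset_union_left, fun h => Set.disjoint_left.1 hdisj (h h₂) hK₂⟩
    have hlt₂ : S₂.ncard < S.ncard := Set.ncard_lt_ncard
      ⟨hunion ▸ Set.subset_union_right, fun h => Set.disjoint_left.1 hdisj hK₁ (h h₁)⟩
    obtain ⟨d₁, hd₁⟩ := ih _ hlt₁ S₁ rfl hconn₁
    obtain ⟨d₂, hd₂⟩ := ih _ hlt₂ S₂ rfl hconn₂
    exact ⟨_, FindBiclique.cut S S₁ S₂ K₁ K₂ d₁ d₂ hnt hunion hdisj hconn₁ hconn₂ hK₁ hK₂ hadj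
      (fun K hK K' hK' h => hmax (K, K') ⟨hK, hK', h⟩) hd₁ hd₂⟩

end Cuts

/-! ### Cuts give bicliques, and bicliques across a tree edge merge. -/

section Merging

variable {V : Type*} [Finite V] {G : SimpleGraph V} {T : SimpleGraph (MaxClique Gᶜ)}
  {σ : MaxClique Gᶜ → ℕ}

/-- A clique shared by vertices of the two sides lies on one side of the cut edge, which forces one
of these vertices into the removed intersection. Neither end clique contains the other, so both
sides are nonempty. -/
theorem IsCut.isBiclique (hT : IsCliqueTree Gᶜ T) {S : Set (MaxClique Gᶜ)} {E : Entry V}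
    (h : IsCut T σ S E) : IsBiclique G E.1.1 E.1.2 := by
  obtain ⟨-, S₁, S₂, K₁, K₂, -, hdisj, hconn₁, hconn₂, hK₁, hK₂, hadj, rfl⟩ := h
  refine isBiclique_of_adj ?_ ?_ ?_
  · obtain ⟨x, hx, hx'⟩ := MaxClique.exists_mem_notMem hadj.ne
    exact ⟨x, mem_cliqueUnion.2 ⟨K₁, hK₁, hx⟩, fun h => hx' h.2⟩
  · obtain ⟨x, hx, hx'⟩ := MaxClique.exists_mem_notMem hadj.ne'
    exact ⟨x, mem_cliqueUnion.2 ⟨K₂, hK₂, hx⟩, fun h => hx' h.1⟩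
  · rintro x ⟨hx, hxn⟩ y ⟨hy, hyn⟩
    rw [adj_iff_forall_maxClique]
    intro K hxK hyK
    obtain ⟨A, hA, hxA⟩ := mem_cliqueUnion.1 hx
    obtain ⟨B, hB, hyB⟩ := mem_cliqueUnion.1 hy
    have hA' := reachable_deleteEdges_of_connected_induce (a := K₁) hconn₁ hK₁ hA
      (fun h => Set.disjoint_left.1 hdisj h.2 hK₂)
    have hB' := reachable_deleteEdges_of_connected_induce (b := K₂) hconn₂ hK₂ hB
      (fun h => Set.disjoint_left.1 hdisj hK₁ h.1)
    rcases reachable_deleteEdges_or hT.1.connected K₁ K₂ K with hK | hK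
    · exact hyn (hT.inter_subset hadj hK hB' hyK hyB)
    · exact hxn (hT.inter_subset hadj hA' hK hxA hxK)

/-- Nonadjacency across the edge needs one vertex in `a` and the other in `b`. As `a` misses a side
of `B` and `b` a side of `B'`, uniting the two remaining sides leaves no possibly nonadjacent pair
between the merged sides. -/
theorem mergeable_of_separating_edge (hT : IsCliqueTree Gᶜ T) (h2 : AtMostTwoCliques Gᶜ)
    {a b : MaxClique Gᶜ} (hab : T.Adj a b) {B B' : Set V × Set V} (hB : IsBiclique G B.1 B.2)
    (hB' : IsBiclique G B'.1 B'.2)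
    (hside : ∀ x ∈ B.1 ∪ B.2, ∃ A : MaxClique Gᶜ,
      (T.deleteEdges {s(a, b)}).Reachable a A ∧ x ∈ A.1)
    (hside' : ∀ y ∈ B'.1 ∪ B'.2, ∃ A : MaxClique Gᶜ,
      (T.deleteEdges {s(a, b)}).Reachable b A ∧ y ∈ A.1) : Mergeable G B B' := by
  have hadj : ∀ x ∈ B.1 ∪ B.2, ∀ y ∈ B'.1 ∪ B'.2, (x ∉ a.1 ∨ y ∉ b.1) → G.Adj x y := by
    intro x hx y hy hxy
    rw [adj_iff_forall_maxClique]
    intro K hxK hyK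
    obtain ⟨A, hA, hxA⟩ := hside x hx
    obtain ⟨A', hA', hyA'⟩ := hside' y hy
    obtain ⟨h₁, h₂⟩ := hT.mem_ends_of_share h2 hab hA hA' hxA hyA' hxK hyK
    exact hxy.elim (fun h => h h₁) (fun h => h h₂)
  have honly : ∀ (C : Set V × Set V) (K : MaxClique Gᶜ), IsBiclique G C.1 C.2 →
      (∀ x ∈ C.1, x ∉ K.1) ∨ ∀ x ∈ C.2, x ∉ K.1 := by
    intro C K hC
    by_contra! hno
    obtain ⟨⟨x, hx, hxK⟩, y, hy, hyK⟩ := hno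
    exact not_adj_of_mem_maxClique K hxK hyK (hC.2.2.2 x hx y hy)
  have hsame : (∀ x ∈ B.1, ∀ y ∈ B'.2, x ∉ a.1 ∨ y ∉ b.1) →
      (∀ x ∈ B.2, ∀ y ∈ B'.1, x ∉ a.1 ∨ y ∉ b.1) → Mergeable G B B' := by
    intro h₁ h₂
    refine Or.inl (isBiclique_of_adj hB.1.inl hB.2.1.inl ?_)
    rintro x (hx | hx) y (hy | hy)
    · exact hB.2.2.2 x hx y hy
    · exact hadj x (Or.inl hx) y (Or.inr hy) (h₁ x hx y hy)
    · exact (hadj y (Or.inr hy) x (Or.inl hx) (h₂ y hy x hx)).symm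
    · exact hB'.2.2.2 x hx y hy
  have hswap : (∀ x ∈ B.1, ∀ y ∈ B'.1, x ∉ a.1 ∨ y ∉ b.1) →
      (∀ x ∈ B.2, ∀ y ∈ B'.2, x ∉ a.1 ∨ y ∉ b.1) → Mergeable G B B' := by
    intro h₁ h₂
    refine Or.inr (isBiclique_of_adj hB.2.1.inl hB.1.inl ?_)
    rintro x (hx | hx) y (hy | hy)
    · exact (hB.2.2.2 y hy x hx).symm
    · exact hadj x (Or.inr hx) y (Or.inr hy) (h₂ x hx y hy)
    · exact (hadj y (Or.inl hy) x (Or.inl hx) (h₁ y hy x hx)).symm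
    · exact hB'.2.2.2 x hx y hy
  rcases honly B a hB with h | h <;> rcases honly B' b hB' with h' | h'
  · exact hsame (fun x hx _ _ => Or.inl (h x hx)) (fun _ _ y hy => Or.inr (h' y hy))
  · exact hswap (fun x hx _ _ => Or.inl (h x hx)) (fun _ _ y hy => Or.inr (h' y hy))
  · exact hswap (fun _ _ y hy => Or.inr (h' y hy)) (fun x hx _ _ => Or.inl (h x hx))
  · exact hsame (fun _ _ y hy => Or.inr (h' y hy)) (fun x hx _ _ => Or.inl (h x hx))

end Merging

/-! ### Merging whole levels, and runs of the algorithm. -/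

section Algorithm

variable {V : Type*} {G : SimpleGraph V}

theorem mergeInto_spec {B B' : Set V × Set V} (h : Mergeable G B B') :
    IsBiclique G (mergeInto G B B').1 (mergeInto G B B').2 ∧
      (B'.1 ⊆ (mergeInto G B B').1 ∧ B'.2 ⊆ (mergeInto G B B').2) ∧
      ((B.1 ⊆ (mergeInto G B B').1 ∧ B.2 ⊆ (mergeInto G B B').2) ∨
        (B.1 ⊆ (mergeInto G B B').2 ∧ B.2 ⊆ (mergeInto G B B').1)) ∧
      (mergeInto G B B').1 ∪ (mergeInto G B B').2 ⊆ (B'.1 ∪ B'.2) ∪ (B.1 ∪ B.2) := by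
  unfold mergeInto
  split_ifs with h₁ h₂
  · exact ⟨h₁, by simp, by simp, by grind⟩
  · exact ⟨h₂, by simp, by simp, by grind⟩
  · exact absurd h (not_or.2 ⟨h₁, h₂⟩)

/-- Lifts the sorting of entries to the list of cuts, which also remembers the subtrees. -/
theorem exists_perm_map_eq {α β : Type*} (f : α → β) {l : List β} {l' : List α}
    (h : l.Perm (l'.map f)) : ∃ l'' : List α, l''.Perm l' ∧ l''.map f = l := by
  have hforall : List.Forall₂ (fun b a => b = f a) (l'.map f) l' := by
    rw [List.forall₂_map_left_iff, List.forall₂_same]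
    exact fun _ _ => rfl
  obtain ⟨l'', hl, hperm⟩ := List.perm_comp_forall₂ h hforall
  refine ⟨l'', hperm, ?_⟩
  rw [← List.forall₂_eq_eq_eq, List.forall₂_map_left_iff]
  exact hl.flip.imp fun _ _ h => h.symm

variable [Finite V] {T : SimpleGraph (MaxClique Gᶜ)} {σ : MaxClique Gᶜ → ℕ}

/-- Treating the cuts of pairwise disjoint subtrees in the order of a breadth-first search merges
them all into a single biclique. -/
theorem foldl_mergeRound_spec (hT : IsCliqueTree Gᶜ T) (h2 : AtMostTwoCliques Gᶜ)
    (hσ : IsBFSOrdering T σ) (ps : List (Set (MaxClique Gᶜ) × Entry V))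
    (hcut : ∀ p ∈ ps, IsCut T σ p.1 p.2) (hdisj : ps.Pairwise fun p q => Disjoint p.1 q.1)
    (hsorted : ps.Pairwise fun p q => p.2.2 ≤ q.2.2) (hne : ps ≠ []) :
    ∃ M : Set V × Set V, (ps.map fun p => p.2.1).foldl (mergeRound G) [] = [M] ∧
      IsBiclique G M.1 M.2 ∧ (∀ x ∈ M.1 ∪ M.2, ∃ p ∈ ps, x ∈ cliqueUnion p.1) ∧
      ∀ p ∈ ps, (p.2.1.1 ⊆ M.1 ∧ p.2.1.2 ⊆ M.2) ∨ (p.2.1.1 ⊆ M.2 ∧ p.2.1.2 ⊆ M.1) := by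
  -- Induction from the right follows the left fold: the last cut meets the single biclique formed
  -- by all earlier ones.
  induction ps using List.reverseRecOn with
  | nil => exact absurd rfl hne
  | append_singleton ps p ih =>
    have hp : IsCut T σ p.1 p.2 := hcut p (by simp)
    rw [List.map_append, List.foldl_append, List.map_singleton, List.foldl_cons, List.foldl_nil]
    rcases eq_or_ne ps [] with rfl | hps
    · refine ⟨p.2.1, by simp [mergeRound], hp.isBiclique hT, fun x hx => ⟨p, by simp, hp.subset hx⟩, ?_⟩
      intro q hq
      obtain rfl : q = p := by simpa using hq
      exact Or.inl ⟨subset_rfl, subset_rfl⟩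
    · rw [List.pairwise_append] at hdisj hsorted
      obtain ⟨M, hM, hbi, hsub, hcov⟩ := ih (fun q hq => hcut q (by simp [hq])) hdisj.1 hsorted.1 hps
      -- Sorting gives only `≤` between keys; disjoint subtrees and an injective `σ` make it strict.
      have hearlier : ∀ q ∈ ps, ∃ m ∈ q.1, σ m < sInf (σ '' p.1) := by
        intro q hq
        have hq' : IsCut T σ q.1 q.2 := hcut q (by simp [hq])
        have hle := hsorted.2.2 q hq p (by simp)
        have hd := hdisj.2.2 q hq p (by simp)
        have hkey : ∀ q : Set (MaxClique Gᶜ) × Entry V, IsCut T σ q.1 q.2 →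
            ∃ m ∈ q.1, σ m = sInf (σ '' q.1) ∧ q.2.2 = sInf (σ '' q.1) := by
          rintro q ⟨hconn, S₁, S₂, K₁, K₂, -, -, -, -, -, -, -, hE⟩
          obtain ⟨w⟩ := hconn.nonempty
          obtain ⟨m, hm, hσm⟩ := Nat.sInf_mem (Set.Nonempty.image σ ⟨w.1, w.2⟩)
          exact ⟨m, hm, hσm, by rw [hE]⟩
        obtain ⟨m, hm, hσm, hqm⟩ := hkey q hq'
        obtain ⟨a, ha, hσa, hpa⟩ := hkey p hp
        refine ⟨m, hm, lt_of_le_of_ne (by omega) fun h => ?_⟩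
        have : m = a := (hσ.spec hT.1.connected).1 (h.trans hσa.symm)
        exact Set.disjoint_left.1 hd hm (this ▸ ha)
      have hmerge : Mergeable G p.2.1 M := by
        obtain ⟨q₀, hq₀⟩ := List.exists_mem_of_ne_nil ps hps
        obtain ⟨m₀, -, hm₀⟩ := hearlier q₀ hq₀
        obtain ⟨w⟩ := hp.1.nonempty
        obtain ⟨a, ha, b, hb, hab, hreach⟩ :=
          hσ.exists_separating_edge hT.1.connected ⟨w.1, w.2⟩ hm₀
        refine mergeable_of_separating_edge hT h2 hab (hp.isBiclique hT) hbi ?_ ?_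
        · intro x hx
          obtain ⟨A, hA, hxA⟩ := mem_cliqueUnion.1 (hp.subset hx)
          exact ⟨A, reachable_deleteEdges_of_connected_induce hp.1 ha hA fun h => hb h.2, hxA⟩
        · intro y hy
          obtain ⟨q, hq, hyq⟩ := hsub y hy
          obtain ⟨A, hA, hyA⟩ := mem_cliqueUnion.1 hyq
          obtain ⟨m, hm, hlt⟩ := hearlier q hq
          -- Only the earliest clique of `q.1` is known to lie behind the edge; the rest follows
          -- since `q.1` is connected and avoids `a`.
          refine ⟨A, (hreach m hlt).trans ?_, hyA⟩
          refine reachable_deleteEdges_of_connected_induce (hcut q (by simp [hq])).1 hm hA fun h => ?_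
          exact Set.disjoint_left.1 (hdisj.2.2 q hq p (by simp)) h.1 ha
      obtain ⟨hbi', hmono, hnew, hsub'⟩ := mergeInto_spec hmerge
      refine ⟨mergeInto G p.2.1 M, ?_, hbi', ?_, ?_⟩
      · rw [hM]
        simp [mergeRound, hmerge]
      · intro x hx
        rcases hsub' hx with hx | hx
        · obtain ⟨q, hq, hxq⟩ := hsub x hx
          exact ⟨q, by simp [hq], hxq⟩
        · exact ⟨p, by simp, hp.subset hx⟩
      · intro q hq
        rcases List.mem_append.1 hq with hq | hq
        · exact (hcov q hq).imp (fun h => ⟨h.1.trans hmono.1, h.2.trans hmono.2⟩)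
            (fun h => ⟨h.1.trans hmono.2, h.2.trans hmono.1⟩)
        · obtain rfl := List.mem_singleton.1 hq
          exact hnew

/-- Each level contributes at most one biclique, and this biclique contains all entries of the
level. -/
theorem MergeBiclique.spec (hT : IsCliqueTree Gᶜ T) (h2 : AtMostTwoCliques Gᶜ)
    (hσ : IsBFSOrdering T σ) {r : ℕ} {φ : Sym2 (MaxClique Gᶜ) → ℕ} (hφ : IsEdgeRanking T r φ)
    {d : ℕ → List (Entry V)} (hd : FindBiclique T φ σ r Set.univ d) {i : ℕ}
    {M : List (Set V × Set V)} (hM : MergeBiclique G (d i) M) :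
    (∀ B ∈ M, ∀ B' ∈ M, B = B') ∧ (∀ B ∈ M, IsBiclique G B.1 B.2) ∧
      ∀ E ∈ d i, ∃ B ∈ M, (E.1.1 ⊆ B.1 ∧ E.1.2 ⊆ B.2) ∨ (E.1.1 ⊆ B.2 ∧ E.1.2 ⊆ B.1) := by
  have huniv : (T.induce Set.univ).Connected :=
    (SimpleGraph.induceUnivIso T).connected_iff.2 hT.1.connected
  obtain ⟨ps, hmap, hcut, hpw⟩ := hd.exists_cuts hφ huniv i
  obtain ⟨sorted, hperm, hsorted, rfl⟩ := hM
  obtain ⟨qs, hqs, rfl⟩ := exists_perm_map_eq Prod.snd (hmap ▸ hperm)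
  rw [List.map_map]
  rcases eq_or_ne qs [] with rfl | hne
  · have hnil : d i = [] := by simpa using hperm
    simp [hnil]
  · obtain ⟨B, hB, hbi, -, hcov⟩ := foldl_mergeRound_spec hT h2 hσ qs
      (fun p hp => (hcut p (hqs.subset hp)).2.1)
      ((hqs.pairwise_iff fun h => h.symm).2 hpw) (by rwa [List.pairwise_map] at hsorted) hne
    have hB' : (qs.map (Prod.fst ∘ Prod.snd)).foldl (mergeRound G) [] = [B] := hB
    rw [hB']
    refine ⟨by simp, by simpa using hbi, fun E hE => ⟨B, by simp, ?_⟩⟩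
    obtain ⟨p, hp, rfl⟩ := List.mem_map.1 (hperm.symm.subset hE)
    exact hcov p hp

/-- The entries already separate the ends of every edge, merging only enlarges them, and each of the
levels keeps at most one biclique. -/
theorem RunOn.spec (h2 : AtMostTwoCliques Gᶜ) {C : Set (Sym2 (Set V))} (h : RunOn G T C) :
    C.Finite ∧ IsBicliqueCover G C ∧ C.ncard ≤ edgeRankingNumber T := by
  obtain ⟨hT, r, φ, σ, d, M, rfl, hφ, hσ, hd, hM, rfl⟩ := h
  have hspec := fun i hi => MergeBiclique.spec hT h2 hσ hφ hd (hM i hi)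
  refine ⟨Set.toFinite _, ⟨?_, ?_⟩, ?_⟩
  · rintro L R ⟨i, hi, L', R', hmem, heq⟩
    have hbi := (hspec i hi).2.1 _ hmem
    rcases Sym2.eq_iff.1 heq with ⟨rfl, rfl⟩ | ⟨rfl, rfl⟩
    exacts [hbi, hbi.symm]
  · intro u v huv
    have hall : ∀ x : V, x ∈ cliqueUnion (Set.univ : Set (MaxClique Gᶜ)) := by
      intro x
      obtain ⟨K, hle, hK⟩ := Finite.exists_le_maximal (Gᶜ.isClique_singleton x)
      exact mem_cliqueUnion.2 ⟨⟨K, hK⟩, Set.mem_univ _, hle rfl⟩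
    obtain ⟨i, hi, E, hE, hmem⟩ :=
      hd.exists_entry hφ (adj_iff_forall_maxClique.1 huv) (hall u) (hall v)
    obtain ⟨⟨L, R⟩, hB, hsub⟩ := (hspec i hi).2.2 E hE
    have hLR : s(L, R) ∈ {B | ∃ i ∈ Set.Icc 1 (edgeRankingNumber T), ∃ L R : Set V,
        (L, R) ∈ M i ∧ B = s(L, R)} := ⟨i, hi, L, R, hB, rfl⟩
    have hRL := hLR
    rw [Sym2.eq_swap] at hRL
    rcases hmem with ⟨hu, hv⟩ | ⟨hv, hu⟩ <;> rcases hsub with ⟨h₁, h₂⟩ | ⟨h₁, h₂⟩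
    · exact ⟨L, R, hLR, h₁ hu, h₂ hv⟩
    · exact ⟨R, L, hRL, h₁ hu, h₂ hv⟩
    · exact ⟨R, L, hRL, h₂ hu, h₁ hv⟩
    · exact ⟨L, R, hLR, h₂ hu, h₁ hv⟩
  · have hcard : (Set.Icc 1 (edgeRankingNumber T)).ncard = edgeRankingNumber T := by
      rw [Set.ncard_eq_toFinset_card', Set.toFinset_Icc, Nat.card_Icc, Nat.add_sub_cancel]
    -- The first level that returns `B`; this is injective on the output because a level returns at
    -- most one biclique.
    let level : Sym2 (Set V) → ℕ := fun B => sInf {i | i ∈ Set.Icc 1 (edgeRankingNumber T) ∧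
      ∃ L R : Set V, (L, R) ∈ M i ∧ B = s(L, R)}
    have hlevel : ∀ B, (∃ i ∈ Set.Icc 1 (edgeRankingNumber T), ∃ L R : Set V,
        (L, R) ∈ M i ∧ B = s(L, R)) → level B ∈ Set.Icc 1 (edgeRankingNumber T) ∧
          ∃ L R : Set V, (L, R) ∈ M (level B) ∧ B = s(L, R) := by
      rintro B ⟨i, hi⟩
      exact Nat.sInf_mem (s := {i | i ∈ Set.Icc 1 (edgeRankingNumber T) ∧
        ∃ L R : Set V, (L, R) ∈ M i ∧ B = s(L, R)}) ⟨i, hi⟩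
    refine (Set.ncard_le_ncard_of_injOn level (fun B hB => (hlevel B hB).1) ?_
      (Set.toFinite _)).trans hcard.le
    intro B hB B' hB' heq
    obtain ⟨hi, L, R, hmem, rfl⟩ := hlevel B hB
    obtain ⟨-, L', R', hmem', rfl⟩ := hlevel B' hB'
    rw [← heq] at hmem'
    obtain ⟨rfl, rfl⟩ := Prod.mk.inj ((hspec _ hi).1 _ hmem _ hmem')
    rfl

theorem exists_runOn (hT : IsCliqueTree Gᶜ T) : ∃ C, RunOn G T C := by
  obtain ⟨φ, hφ⟩ := exists_isEdgeRanking_edgeRankingNumber T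
  obtain ⟨σ, hσ⟩ := exists_isBFSOrdering hT.1
  have huniv : (T.induce Set.univ).Connected :=
    (SimpleGraph.induceUnivIso T).connected_iff.2 hT.1.connected
  obtain ⟨d, hd⟩ := FindBiclique.exists_of_connected hT.1.isAcyclic φ σ (edgeRankingNumber T) _ _
    rfl huniv
  have hmerge : ∀ l : List (Entry V), ∃ M, MergeBiclique G l M := fun l =>
    ⟨_, l.mergeSort (fun a b => decide (a.2 ≤ b.2)), List.mergeSort_perm _ _, by
      have := List.pairwise_mergeSort (le := fun a b : Entry V => decide (a.2 ≤ b.2))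
        (fun a b c hab hbc => by simp only [decide_eq_true_eq] at *; omega)
        (fun a b => by simp only [Bool.or_eq_true, decide_eq_true_eq]; omega) l
      simpa using this, rfl⟩
  choose merge hmerge using hmerge
  exact ⟨_, hT, _, φ, σ, d, fun i => merge (d i), rfl, hφ, hσ, hd, fun i _ => hmerge (d i), rfl⟩

end Algorithm

end BicliqueCover

/-! ### The main theorem. -/

open BicliqueCover in
theorem mainTheorem6 {V : Type*} [Finite V] (G : SimpleGraph V)
    (hchordal : BicliqueCover.IsChordal Gᶜ)
    (htwo : ∀ v : V, {I : Set V | Maximal G.IsIndepSet I ∧ v ∈ I}.ncard ≤ 2)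
    (htree : ∃ T : SimpleGraph (BicliqueCover.MaxClique Gᶜ), BicliqueCover.IsCliqueTree Gᶜ T ∧
      BicliqueCover.edgeRankingNumber T = ⌈Real.logb 2 (BicliqueCover.mc Gᶜ)⌉₊) :
    BicliqueCover.bc G = ⌈Real.logb 2 (BicliqueCover.mc Gᶜ)⌉₊ ∧
    (∀ T : SimpleGraph (BicliqueCover.MaxClique Gᶜ), BicliqueCover.IsCliqueTree Gᶜ T →
      BicliqueCover.edgeRankingNumber T = ⌈Real.logb 2 (BicliqueCover.mc Gᶜ)⌉₊ →
      (∃ C, BicliqueCover.RunOn G T C) ∧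
        ∀ C, BicliqueCover.RunOn G T C → BicliqueCover.IsMinimumBicliqueCover G C) ∧
    (Gᶜ.Connected →
      (∃ C, BicliqueCover.Run G C) ∧
        ∀ C, BicliqueCover.Run G C → BicliqueCover.IsMinimumBicliqueCover G C) := by
  have h2 := atMostTwoCliques_compl htwo
  obtain ⟨T₀, hT₀, hr₀⟩ := htree
  obtain ⟨C₀, hC₀⟩ := exists_runOn hT₀
  have hbc : bc G = ⌈Real.logb 2 (mc Gᶜ)⌉₊ := by
    obtain ⟨hfin, hcover, hcard⟩ := hC₀.spec h2
    refine le_antisymm ?_ ?_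
    · exact (Nat.sInf_le (⟨C₀, hfin, hcover, rfl⟩ : C₀.ncard ∈
        {k | ∃ C : Set (Sym2 (Set V)), C.Finite ∧ IsBicliqueCover G C ∧ C.ncard = k})).trans (hcard.trans hr₀.le)
    -- The cover `C₀` rules out the default value `0` of an infimum over the empty set.
    · refine le_csInf ⟨_, C₀, hfin, hcover, rfl⟩ ?_
      rintro k ⟨C, -, hC, rfl⟩
      exact hC.ceil_logb_mc_le
  have hmin : ∀ T C, edgeRankingNumber T = ⌈Real.logb 2 (mc Gᶜ)⌉₊ → RunOn G T C →
      IsMinimumBicliqueCover G C := by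
    intro T C hr hrun
    obtain ⟨hfin, hcover, hcard⟩ := hrun.spec h2
    exact ⟨hfin, hcover, le_antisymm (by rw [hbc, ← hr]; exact hcard)
      (hbc ▸ hcover.ceil_logb_mc_le)⟩
  refine ⟨hbc, fun T hT hr => ⟨exists_runOn hT, fun C hC => hmin T C hr hC⟩, fun hconn =>
    ⟨⟨C₀, T₀, hC₀⟩, ?_⟩⟩
  rintro C ⟨T, hrun⟩
  -- Connectedness makes the clique tree unique, so any run uses the tree with the good ranking
  -- number.
  have hTT₀ : T = T₀ := by
    ext K K'
    rw [hrun.1.adj_iff h2 hconn, hT₀.adj_iff h2 hconn]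
  exact hmin T C (hTT₀ ▸ hr₀) hrun
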